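/- Let $\mathbb K$ be $\mathbb R$ or $\mathbb C$, let $X$ be a Hausdorff topological vector space over $\mathbb K$, and let $X'$ be the space of continuous linear functionals $X\to\mathbb K$. Write $\dim_{\mathbb R}$ for the algebraic dimension (a cardinal) over $\mathbb R$. If $2<\dim_{\mathbb R}X<2^{\aleph_0}$ or $2<\dim_{\mathbb R}X'<2^{\aleph_0}$, then there is no supercyclic strongly continuous operator semigroup $\{T_t\}_{t\in\mathbb R_+}$ on $X$, where $\mathbb R_+=[0,\infty)$. Here an operator semigroup $\{T_t\}_{t\in\mathbb R_+}$ on $X$ is a family of continuous linear operators $T_t:X\to X$ with $T_0=I$ and $T_{s+t}=T_tT_s$ for all $s,t\in\mathbb R_+$; it is strongly continuous if for every $x\in X$ the map $t\mapsto T_tx$ from $\mathbb R_+$ to $X$ is continuous; and it is supercyclic if there is $x\in X$ such that $\{zT_tx:z\in\mathbb K,\ t\in\mathbb R_+\}$ is dense in $X$. -/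

import Mathlib

open scoped NNReal Cardinal

/-- A point `x` is universal for the family `f a : X → Y` if `{f a x : a}` is dense in `Y`. -/
def IsUniversalElement {ι X Y : Type*} [TopologicalSpace Y] (f : ι → X → Y) (x : X) : Prop :=
  Dense (Set.range fun a => f a x)

/-- A family of maps is universal if it has a universal element. -/
def IsUniversalFamily {ι X Y : Type*} [TopologicalSpace Y] (f : ι → X → Y) : Prop :=
  ∃ x : X, IsUniversalElement f x

/-- A family `T t` (`t` in an abelian monoid `A`) of continuous linear operators on `X` with
`T 0 = I` and `T (s + t) = T t ∘ T s`. -/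
structure OperatorSemigroup (A 𝕜 X : Type*) [AddCommMonoid A] [RCLike 𝕜] [AddCommGroup X]
    [Module 𝕜 X] [TopologicalSpace X] where
  op : A → X →L[𝕜] X
  op_zero : op 0 = ContinuousLinearMap.id 𝕜 X
  op_add : ∀ s t : A, op (s + t) = (op t).comp (op s)

namespace OperatorSemigroup

/-- Strong continuity: every orbit map `t ↦ T t x` is continuous. -/
def StronglyContinuous {A 𝕜 X : Type*} [AddCommMonoid A] [TopologicalSpace A] [RCLike 𝕜]
    [AddCommGroup X] [Module 𝕜 X] [TopologicalSpace X] (T : OperatorSemigroup A 𝕜 X) : Prop :=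
  ∀ x : X, Continuous fun t : A => T.op t x

/-- Supercyclicity: the family `{z • T t : z ∈ 𝕜, t ∈ A}` is universal. -/
def Supercyclic {A 𝕜 X : Type*} [AddCommMonoid A] [RCLike 𝕜]
    [AddCommGroup X] [Module 𝕜 X] [TopologicalSpace X] (T : OperatorSemigroup A 𝕜 X) : Prop :=
  IsUniversalFamily fun (p : 𝕜 × A) (x : X) => p.1 • T.op p.2 x

end OperatorSemigroup

/-- The (algebraic) dimension over `ℝ` of a vector space over `𝕜 = ℝ` or `ℂ`, as a cardinal. -/
noncomputable def realDim (𝕜 : Type*) (X : Type*) [RCLike 𝕜] [AddCommGroup X] [Module 𝕜 X] :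
    Cardinal :=
  Module.rank ℝ (RestrictScalars ℝ 𝕜 X)

/-! Small dimension forces local finiteness. If an orbit curve spanned an infinite-dimensional space
on every interval near 0, a Cantor scheme would yield continuum many independent points on it
(`exists_linearIndependent_cantor`). So some short arc has finite-dimensional span; one of least
dimension spans an invariant subspace, and injectivity of the operators puts the initial vector into
it. A supercyclic vector thus makes `X` itself finite-dimensional. For the dual, the same argument
for the adjoint semigroup gives a finite-dimensional invariant space of functionals, hence a
finite-dimensional factor of `X`.

It remains to see that a supercyclic semigroup on a finite-dimensional space lives in real dimension
at most 2. The operators generate a commutative algebra `R`, identified with the space by evaluation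
at the supercyclic vector, so the multiples of the semigroup are dense in `R`. A continuous additive
function on `[0, ∞)` is bounded on one side, and this obstructs density twice: two distinct maximal
ideals would give such a function as a log-ratio of characters, and a nonzero maximal ideal would
give one through `M / M²`. So `R` is zero or a field inside `ℂ`. -/

open Filter Topology

/-- Linear independence of finite tuples is an open condition in a Hausdorff topological vector
space. -/
theorem LinearIndependent.eventually_of_t2 {ι 𝕜 V : Type*} [Finite ι] [RCLike 𝕜] [AddCommGroup V]
    [Module 𝕜 V] [TopologicalSpace V] [IsTopologicalAddGroup V] [ContinuousSMul 𝕜 V] [T2Space V]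
    {f : ι → V} (hf : LinearIndependent 𝕜 f) : ∀ᶠ g in 𝓝 f, LinearIndependent 𝕜 g := by
  cases nonempty_fintype ι
  rw [Fintype.linearIndependent_iff] at hf
  -- Coefficients of a relation can be normalised to the unit sphere, whose compactness makes the
  -- condition on `g` open.
  have key : ∀ᶠ g in 𝓝 f, ∀ c ∈ Metric.sphere (0 : ι → 𝕜) 1, ∑ i, c i • g i ≠ 0 := by
    refine (isCompact_sphere (0 : ι → 𝕜) 1).eventually_forall_of_forall_eventually
      (P := fun (g : ι → V) (c : ι → 𝕜) => ∑ i, c i • g i ≠ 0) fun c hc => ?_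
    have hcont : Continuous fun p : (ι → V) × (ι → 𝕜) => ∑ i, p.2 i • p.1 i := by fun_prop
    refine hcont.continuousAt.eventually_ne fun h0 => ?_
    have : c = 0 := funext (hf c h0)
    simp [this] at hc
  filter_upwards [key] with g hg
  rw [Fintype.linearIndependent_iff]
  intro c hc
  by_contra! hne
  obtain ⟨i, hi⟩ := hne
  have hc0 : c ≠ 0 := fun h => hi (by simp [h])
  have hn : ‖c‖ ≠ 0 := norm_ne_zero_iff.2 hc0
  refine hg (((‖c‖⁻¹ : ℝ) : 𝕜) • c) ?_ ?_
  · rw [mem_sphere_zero_iff_norm, norm_smul]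
    simp [hn]
  · simp only [Pi.smul_apply, smul_assoc, ← Finset.smul_sum, hc, smul_zero]

/-! ### Independent points on a continuous curve -/

section CantorScheme

variable {𝕜 V : Type*} [RCLike 𝕜] [AddCommGroup V] [Module 𝕜 V]

/-- If no restriction of a curve to a given finite family of sets has finite-dimensional span, then
one can pick linearly independent points of the curve, one in each set. -/
theorem exists_linearIndependent_of_not_finiteDimensional {ι α : Type*} [Finite ι] (γ : α → V)
    (I : ι → Set α) (hI : ∀ i, ¬ FiniteDimensional 𝕜 (Submodule.span 𝕜 (γ '' I i))) :
    ∃ t : ι → α, (∀ i, t i ∈ I i) ∧ LinearIndependent 𝕜 fun i => γ (t i) := by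
  classical
  cases nonempty_fintype ι
  have hne : ∀ i, (I i).Nonempty := fun i => by
    by_contra h
    rw [Set.not_nonempty_iff_eq_empty] at h
    exact hI i (by rw [h, Set.image_empty, Submodule.span_empty]; infer_instance)
  have key : ∀ s : Finset ι, ∃ t : ι → α, (∀ i, t i ∈ I i) ∧
      LinearIndepOn 𝕜 (fun i => γ (t i)) (s : Set ι) := by
    intro s
    induction s using Finset.induction_on with
    | empty => exact ⟨fun i => (hne i).some, fun i => (hne i).some_mem, by simp⟩
    | insert j s hj ih =>
      obtain ⟨t, ht, hli⟩ := ih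
      have hfin : FiniteDimensional 𝕜 (Submodule.span 𝕜 ((fun i => γ (t i)) '' (s : Set ι))) :=
        FiniteDimensional.span_of_finite 𝕜 (s.finite_toSet.image _)
      obtain ⟨a, ha, hna⟩ : ∃ a ∈ I j,
          γ a ∉ Submodule.span 𝕜 ((fun i => γ (t i)) '' (s : Set ι)) := by
        by_contra! hcon
        refine hI j (Submodule.finiteDimensional_of_le
          (S₂ := Submodule.span 𝕜 ((fun i => γ (t i)) '' (s : Set ι))) (Submodule.span_le.2 ?_))
        rintro _ ⟨a, ha, rfl⟩
        exact hcon a ha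
      have heq : Set.EqOn (fun i => γ (t i)) (fun i => γ (Function.update t j a i)) (s : Set ι) := by
        intro i hi
        have : i ≠ j := fun h => hj (h ▸ hi)
        simp [this]
      refine ⟨Function.update t j a, fun i => ?_, ?_⟩
      · by_cases h : i = j
        · subst h; simpa using ha
        · simpa [h] using ht i
      · rw [Finset.coe_insert]
        refine LinearIndepOn.insert (hli.congr heq) ?_
        rw [← heq.image_eq]
        simpa using hna
  obtain ⟨t, ht, hli⟩ := key Finset.univ
  refine ⟨t, ht, ?_⟩
  rwa [Finset.coe_univ, linearIndepOn_univ_iff] at hli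

variable [TopologicalSpace V] [IsTopologicalAddGroup V] [ContinuousSMul 𝕜 V] [T2Space V]

/-- Shrinking intervals so that all choices of points of a curve become linearly independent. -/
theorem exists_shrink_linearIndependent {ι : Type*} [Finite ι] {γ : ℝ → V} (hγ : Continuous γ)
    (J : ι → ℝ × ℝ) (hJ : ∀ i, (J i).1 < (J i).2)
    (hI : ∀ i, ¬ FiniteDimensional 𝕜 (Submodule.span 𝕜 (γ '' Set.Ioo (J i).1 (J i).2))) :
    ∃ J' : ι → ℝ × ℝ, (∀ i, (J i).1 ≤ (J' i).1 ∧ (J' i).1 < (J' i).2 ∧ (J' i).2 ≤ (J i).2) ∧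
      ∀ t : ι → ℝ, (∀ i, t i ∈ Set.Icc (J' i).1 (J' i).2) →
        LinearIndependent 𝕜 fun i => γ (t i) := by
  cases nonempty_fintype ι
  obtain ⟨t, ht, hli⟩ := exists_linearIndependent_of_not_finiteDimensional γ
    (fun i => Set.Ioo (J i).1 (J i).2) hI
  have hc : Continuous fun (t : ι → ℝ) (i : ι) => γ (t i) := by fun_prop
  have hev := hc.continuousAt.eventually hli.eventually_of_t2
  obtain ⟨r, hr, hball⟩ := Metric.eventually_nhds_iff.1 hev
  refine ⟨fun i => (max (J i).1 (t i - r / 2), min (J i).2 (t i + r / 2)), fun i => ?_,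
    fun u hu => hball ?_⟩
  · have := (ht i).1
    have := (ht i).2
    refine ⟨le_max_left _ _, max_lt (lt_min (hJ i) ?_) (lt_min ?_ ?_), min_le_left _ _⟩ <;> linarith
  · refine (dist_pi_lt_iff hr).2 fun i => ?_
    have h1 := (le_max_right _ _).trans (hu i).1
    have h2 := (hu i).2.trans (min_le_right _ _)
    rw [Real.dist_eq, abs_lt]
    constructor <;> linarith

/-- A continuous curve whose restriction to every subinterval has infinite-dimensional span contains
a linearly independent family of the cardinality of the continuum. -/
theorem exists_linearIndependent_cantor {γ : ℝ → V} (hγ : Continuous γ) {u v : ℝ} (huv : u < v)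
    (hI : ∀ a b, u ≤ a → a < b → b ≤ v →
      ¬ FiniteDimensional 𝕜 (Submodule.span 𝕜 (γ '' Set.Ioo a b))) :
    ∃ t : (ℕ → Bool) → ℝ, LinearIndependent 𝕜 fun β => γ (t β) := by
  classical
  -- Level `n` has one interval per word of length `n`. Both children of an interval are shrunk from
  -- all of it; independence separates them.
  let St : ℕ → Type := fun n =>
    {J : (Fin n → Bool) → ℝ × ℝ // ∀ s, u ≤ (J s).1 ∧ (J s).1 < (J s).2 ∧ (J s).2 ≤ v}
  have step : ∀ (n : ℕ) (p : St n), ∃ q : St (n + 1),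
      (∀ s : Fin (n + 1) → Bool, (p.1 (fun i => s i.castSucc)).1 ≤ (q.1 s).1 ∧
        (q.1 s).2 ≤ (p.1 (fun i => s i.castSucc)).2) ∧
      ∀ t : (Fin (n + 1) → Bool) → ℝ, (∀ s, t s ∈ Set.Icc (q.1 s).1 (q.1 s).2) →
        LinearIndependent 𝕜 fun s => γ (t s) := by
    intro n p
    obtain ⟨J', h1, h2⟩ := exists_shrink_linearIndependent (𝕜 := 𝕜) hγ
      (fun s : Fin (n + 1) → Bool => p.1 (fun i => s i.castSucc)) (fun s => (p.2 _).2.1)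
      (fun s => hI _ _ (p.2 _).1 (p.2 _).2.1 (p.2 _).2.2)
    exact ⟨⟨J', fun s => ⟨(p.2 _).1.trans (h1 s).1, (h1 s).2.1, (h1 s).2.2.trans (p.2 _).2.2⟩⟩,
      fun s => ⟨(h1 s).1, (h1 s).2.2⟩, h2⟩
  choose next hnest hli using step
  let p : ∀ n, St n := fun n =>
    Nat.rec (motive := St) ⟨fun _ => (u, v), fun _ => ⟨le_rfl, huv, le_rfl⟩⟩ next n
  have hp : ∀ n, p (n + 1) = next n (p n) := fun n => rfl
  let r : (ℕ → Bool) → ∀ n, Fin n → Bool := fun β n i => β i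
  have hr : ∀ β n, (fun i : Fin n => r β (n + 1) i.castSucc) = r β n := fun β n => rfl
  have hpt : ∀ β : ℕ → Bool, ∃ t : ℝ, ∀ n, t ∈ Set.Icc ((p n).1 (r β n)).1 ((p n).1 (r β n)).2 := by
    intro β
    have := IsCompact.nonempty_iInter_of_sequence_nonempty_isCompact_isClosed
      (fun n => Set.Icc ((p n).1 (r β n)).1 ((p n).1 (r β n)).2) (fun n => by
        have := hnest n (p n) (r β (n + 1))
        rw [hr, ← hp] at this
        exact Set.Icc_subset_Icc this.1 this.2)
      (fun n => Set.nonempty_Icc.2 ((p n).2 _).2.1.le) isCompact_Icc (fun n => isClosed_Icc)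
    obtain ⟨t, ht⟩ := this
    exact ⟨t, fun n => Set.mem_iInter.1 ht n⟩
  choose t ht using hpt
  refine ⟨t, linearIndependent_iff_finset_linearIndependent.2 fun s => ?_⟩
  -- Finitely many branches already differ in their first `n + 1` digits.
  obtain ⟨n, hn⟩ : ∃ n, Set.InjOn (fun β => r β (n + 1)) (s : Set (ℕ → Bool)) := by
    have hd : ∀ q : (ℕ → Bool) × (ℕ → Bool), ∃ k, q.1 ≠ q.2 → q.1 k ≠ q.2 k := fun q => by
      by_cases h : q.1 = q.2
      · exact ⟨0, fun h' => (h' h).elim⟩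
      · obtain ⟨k, hk⟩ := Function.ne_iff.1 h
        exact ⟨k, fun _ => hk⟩
    choose k hk using hd
    refine ⟨(s ×ˢ s).sup k, fun β hβ β' hβ' heq => ?_⟩
    by_contra hne
    refine hk (β, β') hne ?_
    have hle : k (β, β') ≤ (s ×ˢ s).sup k :=
      Finset.le_sup (f := k) (Finset.mem_product.2 ⟨hβ, hβ'⟩)
    exact congrFun heq ⟨k (β, β'), Nat.lt_succ_of_le hle⟩
  -- `hli` needs a point for every word, so words not met by `s` get a left endpoint.
  let T : (Fin (n + 1) → Bool) → ℝ := fun σ =>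
    if h : ∃ β ∈ s, r β (n + 1) = σ then t h.choose else ((p (n + 1)).1 σ).1
  have hT : ∀ β ∈ s, T (r β (n + 1)) = t β := fun β hβ => by
    have h : ∃ β' ∈ s, r β' (n + 1) = r β (n + 1) := ⟨β, hβ, rfl⟩
    have h' : h.choose = β := hn h.choose_spec.1 hβ h.choose_spec.2
    simp only [T, dif_pos h, h']
  have hTmem : ∀ σ, T σ ∈ Set.Icc ((p (n + 1)).1 σ).1 ((p (n + 1)).1 σ).2 := fun σ => by
    by_cases h : ∃ β ∈ s, r β (n + 1) = σ
    · obtain ⟨β, hβ, rfl⟩ := h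
      rw [hT β hβ]
      exact ht β (n + 1)
    · simp only [T, dif_neg h]
      exact Set.left_mem_Icc.2 ((p (n + 1)).2 _).2.1.le
  have hfin := (hli n (p n) T hTmem).comp (fun β : s => r β.1 (n + 1))
    fun β β' h => Subtype.ext (hn β.2 β'.2 h)
  have heq : (fun β => γ (t β)) ∘ (Subtype.val : s → _) =
      (fun σ => γ (T σ)) ∘ fun β : s => r β.1 (n + 1) :=
    funext fun β => by simp only [Function.comp_apply, hT β.1 β.2]
  rw [heq]
  exact hfin

end CantorScheme

/-- Independence over `𝕜` implies independence over `ℝ`, and the index set has the cardinality of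
the continuum. -/
theorem two_power_aleph0_le_realDim {𝕜 V : Type*} [RCLike 𝕜] [AddCommGroup V] [Module 𝕜 V]
    {f : (ℕ → Bool) → V} (hf : LinearIndependent 𝕜 f) : 2 ^ ℵ₀ ≤ realDim 𝕜 V := by
  let _ : Module ℝ V := Module.compHom V (algebraMap ℝ 𝕜)
  have : IsScalarTower ℝ 𝕜 V := ⟨fun a b v => by
    rw [Algebra.smul_def, mul_smul]
    rfl⟩
  have := (hf.restrict_scalars' ℝ).cardinal_lift_le_rank
  change 2 ^ ℵ₀ ≤ Module.rank ℝ V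
  simpa using this

/-! ### Semigroups on spaces of dimension below the continuum -/

/-- A strongly continuous semigroup acts injectively on finite-dimensional invariant subspaces. -/
theorem eq_zero_of_mem_finiteDimensional_invariant {𝕜 V : Type*} [RCLike 𝕜]
    [AddCommGroup V] [Module 𝕜 V] [TopologicalSpace V] [T2Space V] {T : ℝ≥0 → V →ₗ[𝕜] V}
    (h0 : T 0 = LinearMap.id)
    (hadd : ∀ s t, T (s + t) = T t ∘ₗ T s) (hcont : ∀ v, Continuous fun t => T t v)
    {Y : Submodule 𝕜 V} [FiniteDimensional 𝕜 Y] (hY : ∀ t, ∀ y ∈ Y, T t y ∈ Y)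
    {t : ℝ≥0} {y : V} (hy : y ∈ Y) (hty : T t y = 0) : y = 0 := by
  classical
  let K : ℝ≥0 → Submodule 𝕜 V := fun s => Y ⊓ LinearMap.ker (T s)
  have hKfin : ∀ s, FiniteDimensional 𝕜 (K s) := fun s =>
    Submodule.finiteDimensional_of_le inf_le_left
  have hKmono : ∀ s s', s ≤ s' → K s ≤ K s' := by
    intro s s' hs w hw
    refine ⟨hw.1, ?_⟩
    have h2 : T s w = 0 := hw.2
    change T s' w = 0
    rw [← add_tsub_cancel_of_le hs, hadd, LinearMap.comp_apply, h2, map_zero]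
  -- The kernels grow with `s`, so least dimension at `δ` makes them constant on `(0, δ]`. A vector
  -- killed by `T δ` is killed by all small positive times; let `s → 0`.
  let P : ℕ → Prop := fun n => ∃ s > 0, Module.finrank 𝕜 (K s) = n
  have hP : ∃ n, P n := ⟨_, 1, one_pos, rfl⟩
  obtain ⟨δ, hδ, hrank⟩ := Nat.find_spec hP
  have hKeq : ∀ s, 0 < s → s ≤ δ → K s = K δ := fun s hs hsδ =>
    Submodule.eq_of_le_of_finrank_le (hKmono s δ hsδ) (by
      rw [hrank]; exact Nat.find_min' hP ⟨s, hs, rfl⟩)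
  have hδinj : ∀ w ∈ Y, T δ w = 0 → w = 0 := by
    intro w hw hδw
    have hlim : Tendsto (fun s => T s w) (𝓝[>] 0) (𝓝 (T 0 w)) :=
      ((hcont w).tendsto 0).mono_left nhdsWithin_le_nhds
    have hev : (fun s => T s w) =ᶠ[𝓝[>] 0] fun _ => 0 := by
      filter_upwards [Ioc_mem_nhdsGT hδ] with s hs
      have : w ∈ K s := by rw [hKeq s hs.1 hs.2]; exact ⟨hw, hδw⟩
      exact this.2
    have := tendsto_nhds_unique (hlim.congr' hev) tendsto_const_nhds
    simpa [h0] using this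
  have hn : ∀ n : ℕ, ∀ w ∈ Y, T (n • δ) w = 0 → w = 0 := by
    intro n
    induction n with
    | zero => intro w _ h; simpa [h0] using h
    | succ n ih =>
      intro w hw h
      rw [succ_nsmul', hadd] at h
      exact hδinj w hw (ih _ (hY _ _ hw) h)
  obtain ⟨n, hn'⟩ := Archimedean.arch t hδ
  exact hn n y hy (hKmono t _ hn' ⟨hy, hty⟩).2

section LocallyFinite

variable {𝕜 V : Type*} [RCLike 𝕜] [AddCommGroup V] [Module 𝕜 V]
  [TopologicalSpace V] [IsTopologicalAddGroup V] [ContinuousSMul 𝕜 V] [T2Space V]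
  {T : ℝ≥0 → V →ₗ[𝕜] V}

/-- Arbitrarily early, an orbit enters a finite-dimensional invariant subspace. -/
theorem exists_finiteDimensional_invariant_early (h0 : T 0 = LinearMap.id)
    (hadd : ∀ s t, T (s + t) = T t ∘ₗ T s) (hcont : ∀ v, Continuous fun t => T t v)
    (hdim : realDim 𝕜 V < 2 ^ ℵ₀) (v : V) {ε : ℝ≥0} (hε : 0 < ε) :
    ∃ Y : Submodule 𝕜 V, FiniteDimensional 𝕜 Y ∧ (∀ t, ∀ y ∈ Y, T t y ∈ Y) ∧
      ∃ c < ε, T c v ∈ Y := by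
  classical
  let γ : ℝ → V := fun t => T t.toNNReal v
  have hγ : Continuous γ := (hcont v).comp continuous_real_toNNReal
  -- Finite dimension is demanded separately because `finrank` is 0 on infinite-dimensional spaces.
  let P : ℕ → Prop := fun n => ∃ a b : ℝ, 0 ≤ a ∧ a < b ∧ b ≤ ε ∧
    FiniteDimensional 𝕜 (Submodule.span 𝕜 (γ '' Set.Ioo a b)) ∧
    Module.finrank 𝕜 (Submodule.span 𝕜 (γ '' Set.Ioo a b)) = n
  have hP : ∃ n, P n := by
    by_contra hcon
    obtain ⟨t, ht⟩ := exists_linearIndependent_cantor (𝕜 := 𝕜) hγ (u := 0) (v := ε)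
      (by exact_mod_cast hε) fun a b ha hab hb hfin => hcon ⟨_, a, b, ha, hab, hb, hfin, rfl⟩
    exact absurd (two_power_aleph0_le_realDim ht) (not_le.2 hdim)
  obtain ⟨a, b, ha, hab, hb, hfin, hrank⟩ := Nat.find_spec hP
  set W := Submodule.span 𝕜 (γ '' Set.Ioo a b)
  have hsub : ∀ a' b', a ≤ a' → a' < b' → b' ≤ b → Submodule.span 𝕜 (γ '' Set.Ioo a' b') = W := by
    intro a' b' h1 h2 h3
    have hle : Submodule.span 𝕜 (γ '' Set.Ioo a' b') ≤ W :=
      Submodule.span_mono (Set.image_mono (Set.Ioo_subset_Ioo h1 h3))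
    have hf := Submodule.finiteDimensional_of_le hle
    refine Submodule.eq_of_le_of_finrank_le hle ?_
    rw [hrank]
    exact Nat.find_min' hP ⟨a', b', ha.trans h1, h2, h3.trans hb, hf, rfl⟩
  -- By minimality the left half of the arc already spans `W`, and a shift by at most half its
  -- length stays in the arc.
  have hsmall : ∀ s : ℝ≥0, (s : ℝ) ≤ (b - a) / 2 → ∀ y ∈ W, T s y ∈ W := by
    intro s hs y hy
    rw [← hsub a ((a + b) / 2) le_rfl (by linarith) (by linarith)] at hy
    have : Submodule.span 𝕜 (γ '' Set.Ioo a ((a + b) / 2)) ≤ W.comap (T s) := by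
      refine Submodule.span_le.2 ?_
      rintro _ ⟨t, ht, rfl⟩
      have ht0 : 0 ≤ t := ha.trans ht.1.le
      refine Submodule.subset_span ⟨t + s, ⟨?_, ?_⟩, ?_⟩
      · have := ht.1; have := s.2; simp only [NNReal.val_eq_coe] at this; linarith
      · have := ht.2; linarith
      · simp only [γ]
        rw [Real.toNNReal_add ht0 s.coe_nonneg, Real.toNNReal_coe, hadd]
        rfl
    exact this hy
  have hmul : ∀ (n : ℕ) (s : ℝ≥0), (s : ℝ) ≤ (b - a) / 2 → ∀ y ∈ W, T (n • s) y ∈ W := by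
    intro n s hs
    induction n with
    | zero => intro y hy; simpa [h0] using hy
    | succ n ih =>
      intro y hy
      rw [succ_nsmul, hadd]
      exact hsmall s hs _ (ih y hy)
  refine ⟨W, hfin, fun t y hy => ?_, ((a + b) / 2).toNNReal, ?_, ?_⟩
  · obtain ⟨n, hn⟩ := exists_nat_gt ((t : ℝ) / ((b - a) / 2))
    have hpos : 0 < (b - a) / 2 := by linarith
    have hn0 : 0 < n := by
      have : (0 : ℝ) < n := lt_of_le_of_lt (by positivity) hn
      exact_mod_cast this
    have hn0' : (n : ℝ≥0) ≠ 0 := by exact_mod_cast hn0.ne'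
    have : t = n • (t / n) := by rw [nsmul_eq_mul, mul_div_cancel₀ _ hn0']
    rw [this]
    refine hmul n (t / n) ?_ y hy
    rw [div_lt_iff₀ hpos] at hn
    rw [NNReal.coe_div, NNReal.coe_natCast, div_le_iff₀ (by exact_mod_cast hn0)]
    linarith
  · rw [Real.toNNReal_lt_iff_lt_coe (by linarith)]
    linarith
  · exact Submodule.subset_span ⟨(a + b) / 2, ⟨by linarith, by linarith⟩, rfl⟩

/-- On a space of dimension less than the continuum, every operator of a strongly continuous
semigroup is injective. -/
theorem injective_of_realDim_lt (h0 : T 0 = LinearMap.id)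
    (hadd : ∀ s t, T (s + t) = T t ∘ₗ T s) (hcont : ∀ v, Continuous fun t => T t v)
    (hdim : realDim 𝕜 V < 2 ^ ℵ₀) (t : ℝ≥0) : Function.Injective (T t) := by
  rw [injective_iff_map_eq_zero]
  intro v hv
  by_contra hv0
  have ht : 0 < t := by
    rw [pos_iff_ne_zero]
    rintro rfl
    exact hv0 (by simpa [h0] using hv)
  have hev : ∀ᶠ s in 𝓝 (0 : ℝ≥0), T s v ≠ 0 :=
    (hcont v).continuousAt.eventually_ne (by simpa [h0] using hv0)
  obtain ⟨ε, hε, hball⟩ := Metric.eventually_nhds_iff.1 hev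
  have hpos : 0 < min ε.toNNReal t := lt_min (Real.toNNReal_pos.2 hε) ht
  obtain ⟨Y, hfin, hY, c, hc, hcv⟩ :=
    exists_finiteDimensional_invariant_early h0 hadd hcont hdim v hpos
  -- `T c v` is nonzero since `c < ε`, yet it lies in `Y` and is killed by `T t`, which commutes
  -- with `T c`.
  refine hball (y := c) ?_ (eq_zero_of_mem_finiteDimensional_invariant h0 hadd hcont hY hcv (t := t) ?_)
  · have := Real.lt_toNNReal_iff_coe_lt.1 (lt_min_iff.1 hc).1
    simpa [NNReal.dist_eq] using this
  · rw [← LinearMap.comp_apply, ← hadd, add_comm, hadd, LinearMap.comp_apply, hv, map_zero]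

/-- On a space of dimension less than the continuum, every vector lies in a finite-dimensional
invariant subspace of a given strongly continuous semigroup. -/
theorem exists_finiteDimensional_invariant (h0 : T 0 = LinearMap.id)
    (hadd : ∀ s t, T (s + t) = T t ∘ₗ T s) (hcont : ∀ v, Continuous fun t => T t v)
    (hdim : realDim 𝕜 V < 2 ^ ℵ₀) (v : V) :
    ∃ Y : Submodule 𝕜 V, FiniteDimensional 𝕜 Y ∧ (∀ t, ∀ y ∈ Y, T t y ∈ Y) ∧ v ∈ Y := by
  obtain ⟨Y, hfin, hY, c, -, hcv⟩ :=
    exists_finiteDimensional_invariant_early h0 hadd hcont hdim v one_pos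
  have hinj := injective_of_realDim_lt h0 hadd hcont hdim c
  -- On `Y` injective means surjective, so `T c v = T c y` with `y ∈ Y`, and then `v = y`.
  have hsurj : Function.Surjective ((T c).restrict (hY c)) :=
    LinearMap.injective_iff_surjective.1 fun y y' h =>
      Subtype.ext (hinj (congrArg Subtype.val h))
  obtain ⟨y, hy⟩ := hsurj ⟨T c v, hcv⟩
  have : (y : V) = v := hinj (congrArg Subtype.val hy)
  exact ⟨Y, hfin, hY, this ▸ y.2⟩

end LocallyFinite

/-! ### Multiplicative and additive functions of time -/

/-- A continuous multiplicative map from `[0, ∞)` to a Banach algebra takes values in the units. -/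
theorem isUnit_of_continuous_mul {A : Type*} [NormedRing A] [HasSummableGeomSeries A] {c : ℝ≥0 → A}
    (hc : Continuous c) (h0 : c 0 = 1) (hadd : ∀ s t, c (s + t) = c s * c t) (t : ℝ≥0) :
    IsUnit (c t) := by
  have hpow : ∀ (n : ℕ) s, c (n • s) = c s ^ n := by
    intro n s
    induction n with
    | zero => simp [h0]
    | succ n ih => rw [succ_nsmul, hadd, ih, pow_succ]
  have hev : ∀ᶠ s in 𝓝 (0 : ℝ≥0), IsUnit (c s) :=
    hc.continuousAt.eventually (Units.isOpen.mem_nhds (by simp [h0]))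
  have hlim : Tendsto (fun n : ℕ => t / (n + 1 : ℕ)) atTop (𝓝 (0 : ℝ≥0)) :=
    (tendsto_const_div_atTop_nhds_zero_nat t).comp (tendsto_add_atTop_nat 1)
  obtain ⟨n, hn⟩ := (hlim.eventually hev).exists
  have hn0 : ((n + 1 : ℕ) : ℝ≥0) ≠ 0 := by exact_mod_cast n.succ_ne_zero
  have : t = (n + 1) • (t / (n + 1 : ℕ)) := by rw [nsmul_eq_mul, mul_div_cancel₀ _ hn0]
  rw [this, hpow]
  exact hn.pow _

/-- Every real algebra homomorphism from `ℝ` or `ℂ` to `ℂ` is isometric. -/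
theorem norm_realAlgHom_apply {𝕜 : Type*} [RCLike 𝕜] (ζ : 𝕜 →ₐ[ℝ] ℂ) (z : 𝕜) :
    ‖ζ z‖ = ‖z‖ := by
  have hre : ∀ x : ℝ, ζ (x : 𝕜) = x := fun x => ζ.commutes x
  have hz : ζ z = (RCLike.re z : ℂ) + (RCLike.im z : ℂ) * ζ RCLike.I := by
    conv_lhs => rw [← RCLike.re_add_im z]
    rw [map_add, map_mul, hre, hre]
  -- Either `RCLike.I` is 0, or `ζ` sends it to `±Complex.I`.
  rcases RCLike.I_mul_I_ax (K := 𝕜) with h | h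
  · have hz' : z = (RCLike.re z : 𝕜) := by
      conv_lhs => rw [← RCLike.re_add_im z]
      simp [h]
    rw [hz', hre]
    simp
  · have h2 : ζ RCLike.I * ζ RCLike.I = -1 := by rw [← map_mul, h, map_neg, map_one]
    rw [← Complex.I_mul_I, mul_self_eq_mul_self_iff] at h2
    refine (sq_eq_sq₀ (norm_nonneg _) (norm_nonneg _)).1 ?_
    rw [RCLike.norm_sq_eq_def (z := z), hz, ← Complex.normSq_eq_norm_sq, Complex.normSq_apply]
    rcases h2 with h2 | h2 <;> simp [h2]

/-- A continuous additive function on `[0, ∞)` is bounded on one side. -/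
theorem bddAbove_or_bddBelow_of_continuous_add {a : ℝ≥0 → ℝ} (ha : Continuous a)
    (hadd : ∀ s t, a (s + t) = a s + a t) :
    (∃ C, ∀ t, a t ≤ C) ∨ ∃ C, ∀ t, C ≤ a t := by
  obtain ⟨C, hC⟩ := (isCompact_Icc (a := (0 : ℝ≥0)) (b := 1)).exists_bound_of_continuousOn
    ha.continuousOn
  have hnat : ∀ n : ℕ, a n = n * a 1 := by
    intro n
    induction n with
    | zero => have := hadd 0 0; simp at this; simp [this]
    | succ n ih => push_cast; rw [hadd, ih]; ring
  -- The fractional part contributes a bounded term, so the sign of `a 1` decides the side.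
  have hdec : ∀ t, a t = ⌊t⌋₊ * a 1 + a (t - ⌊t⌋₊) := by
    intro t
    rw [← hnat, ← hadd, add_tsub_cancel_of_le (Nat.floor_le zero_le)]
  have hfr : ∀ t : ℝ≥0, |a (t - ⌊t⌋₊)| ≤ C := fun t => by
    refine hC _ ⟨zero_le, ?_⟩
    rw [tsub_le_iff_left]
    exact (Nat.lt_floor_add_one t).le
  rcases le_total (a 1) 0 with h | h
  · left
    refine ⟨C, fun t => ?_⟩
    rw [hdec]
    have := mul_nonpos_of_nonneg_of_nonpos (Nat.cast_nonneg (α := ℝ) ⌊t⌋₊) h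
    linarith [(abs_le.1 (hfr t)).2]
  · right
    refine ⟨-C, fun t => ?_⟩
    rw [hdec]
    have := mul_nonneg (Nat.cast_nonneg (α := ℝ) ⌊t⌋₊) h
    linarith [(abs_le.1 (hfr t)).1]

/-! ### Finite-dimensional algebras with a dense cone over a semigroup -/

section Algebra

variable {𝕜 R : Type*} [RCLike 𝕜] [NormedCommRing R] [NormedAlgebra 𝕜 R] [FiniteDimensional 𝕜 R]
  {S : ℝ≥0 → R}

/-- A commutative algebra in which the multiples of a continuous one-parameter semigroup are dense
has only one maximal ideal. -/
theorem ideal_eq_of_dense_semigroup (hS : Continuous S) (h0 : S 0 = 1)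
    (hadd : ∀ s t, S (s + t) = S s * S t)
    (hD : Dense (Set.range fun p : 𝕜 × ℝ≥0 => p.1 • S p.2))
    (M N : Ideal R) [hM : M.IsMaximal] [hN : N.IsMaximal] : M = N := by
  let _ : NormedAlgebra ℝ R := NormedAlgebra.restrictScalars ℝ 𝕜 R
  have : IsScalarTower ℝ 𝕜 R := RestrictScalars.isScalarTower ℝ 𝕜 R
  have : FiniteDimensional ℝ R := FiniteDimensional.trans ℝ 𝕜 R
  have hhom : ∀ I : Ideal R, I.IsMaximal → ∃ φ : R →ₐ[ℝ] ℂ, RingHom.ker φ = I := by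
    intro I hI
    let _ := Ideal.Quotient.field I
    have : Algebra.IsAlgebraic ℝ (R ⧸ I) := inferInstance
    let ψ : (R ⧸ I) →ₐ[ℝ] ℂ := IsAlgClosed.lift
    refine ⟨ψ.comp (Ideal.Quotient.mkₐ ℝ I), ?_⟩
    ext r
    rw [RingHom.mem_ker]
    simp [Ideal.Quotient.eq_zero_iff_mem]
  have hnorm : ∀ (φ : R →ₐ[ℝ] ℂ) (z : 𝕜), ‖φ (algebraMap 𝕜 R z)‖ = ‖z‖ := by
    exact fun φ z => norm_realAlgHom_apply (φ.comp (IsScalarTower.toAlgHom ℝ 𝕜 R)) z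
  -- The inequality is closed and invariant under scalars, so it spreads from the semigroup to all
  -- of `R`.
  have hdiv : ∀ φ ψ : R →ₐ[ℝ] ℂ, (∃ C : ℝ, ∀ t, ‖φ (S t)‖ ≤ C * ‖ψ (S t)‖) →
      RingHom.ker ψ ≤ RingHom.ker φ := by
    rintro φ ψ ⟨C, hC⟩ r hr
    have hcφ : Continuous φ := φ.toLinearMap.continuous_of_finiteDimensional
    have hcψ : Continuous ψ := ψ.toLinearMap.continuous_of_finiteDimensional
    have hcl : IsClosed {r : R | ‖φ r‖ ≤ C * ‖ψ r‖} :=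
      isClosed_le hcφ.norm (continuous_const.mul hcψ.norm)
    have hsub : (Set.range fun p : 𝕜 × ℝ≥0 => p.1 • S p.2) ⊆ {r : R | ‖φ r‖ ≤ C * ‖ψ r‖} := by
      rintro _ ⟨⟨z, t⟩, rfl⟩
      simp only [Set.mem_ofPred_eq, Algebra.smul_def, map_mul, norm_mul, hnorm]
      calc ‖z‖ * ‖φ (S t)‖ ≤ ‖z‖ * (C * ‖ψ (S t)‖) := by gcongr; exact hC t
        _ = _ := by ring
    have hall : r ∈ {r : R | ‖φ r‖ ≤ C * ‖ψ r‖} := by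
      have : closure _ ⊆ _ := hcl.closure_subset_iff.2 hsub
      exact this (hD r)
    rw [RingHom.mem_ker] at hr ⊢
    simp only [Set.mem_ofPred_eq] at hall
    have hr' : ψ r = 0 := hr
    rw [hr', norm_zero, mul_zero, norm_le_zero_iff] at hall
    exact hall
  obtain ⟨φ, rfl⟩ := hhom M hM
  obtain ⟨ψ, rfl⟩ := hhom N hN
  have hφ : ∀ φ : R →ₐ[ℝ] ℂ, Continuous (fun t => φ (S t)) := fun φ =>
    (φ.toLinearMap.continuous_of_finiteDimensional).comp hS
  have hne : ∀ (φ : R →ₐ[ℝ] ℂ) t, φ (S t) ≠ 0 := fun φ t =>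
    (isUnit_of_continuous_mul (hφ φ) (by simp [h0]) (fun s t => by rw [hadd, map_mul]) t).ne_zero
  have hlog : ∀ (φ : R →ₐ[ℝ] ℂ), Continuous fun t => Real.log ‖φ (S t)‖ := fun φ =>
    (hφ φ).norm.log fun t => norm_ne_zero_iff.2 (hne φ t)
  have hlogadd : ∀ (φ : R →ₐ[ℝ] ℂ) s t,
      Real.log ‖φ (S (s + t))‖ = Real.log ‖φ (S s)‖ + Real.log ‖φ (S t)‖ := fun φ s t => by
    rw [hadd, map_mul, norm_mul, Real.log_mul (norm_ne_zero_iff.2 (hne φ s))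
      (norm_ne_zero_iff.2 (hne φ t))]
  have hexp : ∀ (φ ψ : R →ₐ[ℝ] ℂ) (C : ℝ) t,
      Real.log ‖φ (S t)‖ - Real.log ‖ψ (S t)‖ ≤ C → ‖φ (S t)‖ ≤ Real.exp C * ‖ψ (S t)‖ := by
    intro φ ψ C t h
    have h1 := norm_pos_iff.2 (hne φ t)
    have h2 := norm_pos_iff.2 (hne ψ t)
    rw [← Real.log_div h1.ne' h2.ne', Real.log_le_iff_le_exp (by positivity),
      div_le_iff₀ h2] at h
    exact h
  rcases bddAbove_or_bddBelow_of_continuous_add ((hlog φ).sub (hlog ψ))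
    (fun s t => by simp only [Pi.sub_apply, hlogadd]; ring) with ⟨C, hC⟩ | ⟨C, hC⟩
  · exact (hN.eq_of_le hM.ne_top (hdiv φ ψ ⟨_, fun t => hexp φ ψ C t (hC t)⟩)).symm
  · exact hM.eq_of_le hN.ne_top (hdiv ψ φ ⟨_, fun t => hexp ψ φ (-C) t (by
      have := hC t
      simp only [Pi.sub_apply] at this
      linarith)⟩)

/-- If the multiples of a continuous one-parameter semigroup are dense in a local algebra, then the
maximal ideal vanishes. -/
theorem maximalIdeal_eq_bot_of_dense_semigroup (hS : Continuous S) (h0 : S 0 = 1)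
    (hadd : ∀ s t, S (s + t) = S s * S t)
    (hD : Dense (Set.range fun p : 𝕜 × ℝ≥0 => p.1 • S p.2))
    (M : Ideal R) [hM : M.IsMaximal] : M = ⊥ := by
  let _ : NormedAlgebra ℝ R := NormedAlgebra.restrictScalars ℝ 𝕜 R
  have : IsScalarTower ℝ 𝕜 R := RestrictScalars.isScalarTower ℝ 𝕜 R
  have : FiniteDimensional ℝ R := FiniteDimensional.trans ℝ 𝕜 R
  have : CompleteSpace R := FiniteDimensional.complete 𝕜 R
  have : IsArtinianRing R := IsArtinianRing.of_finite 𝕜 R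
  have hjac : M = Ideal.jacobson ⊥ := by
    rw [Ideal.jacobson]
    refine le_antisymm (le_sInf fun J hJ => ?_) (sInf_le ⟨bot_le, hM⟩)
    have := hJ.2
    exact (ideal_eq_of_dense_semigroup hS h0 hadd hD M J).le
  have hnil : IsNilpotent M := hjac ▸ IsArtinianRing.isNilpotent_jacobson_bot
  by_contra hMbot
  have hsq : ¬ M ≤ M * M := by
    intro hle
    have heq : M = M * M := le_antisymm hle Ideal.mul_le_left
    have hall : ∀ n, M = M ^ (n + 1) := by
      intro n
      induction n with
      | zero => simp
      | succ n ih => rw [pow_succ, ← ih]; exact heq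
    obtain ⟨n, hn⟩ := hnil
    refine hMbot ?_
    rw [hall n, pow_succ, hn]
    simp
  obtain ⟨m, hmM, hm⟩ := Set.not_subset.1 hsq
  obtain ⟨L, hLm, hL⟩ : ∃ L : R →ₗ[ℝ] ℝ, L m ≠ 0 ∧ ∀ x ∈ M * M, L x = 0 := by
    obtain ⟨f, hf, hfM⟩ := Submodule.exists_le_ker_of_notMem (K := ℝ)
      (p := (M * M).restrictScalars ℝ) (v := m) hm
    exact ⟨f, hf, fun x hx => hfM hx⟩
  let _ := Ideal.Quotient.field M
  let π : R →ₐ[𝕜] R ⧸ M := Ideal.Quotient.mkₐ 𝕜 M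
  have hπ : Function.Surjective π := Ideal.Quotient.mk_surjective
  have hker : RingHom.ker (π : R →+* R ⧸ M) = M := Ideal.Quotient.mkₐ_ker 𝕜 M
  -- The residue field lifts to a subfield of `R`, since it is formally smooth over `𝕜` and `M` is
  -- nilpotent.
  let σ : (R ⧸ M) →ₐ[𝕜] R := Algebra.FormallySmooth.liftOfSurjective (AlgHom.id 𝕜 _) π hπ
    (by change IsNilpotent (RingHom.ker (π : R →+* R ⧸ M)); rw [hker]; exact hnil)
  have hσ : ∀ k, π (σ k) = k := fun k =>
    Algebra.FormallySmooth.liftOfSurjective_apply (AlgHom.id 𝕜 _) π hπ _ k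
  let τ : R →ₐ[𝕜] R := σ.comp π
  have hτ : Continuous τ := τ.toLinearMap.continuous_of_finiteDimensional
  have hLc : Continuous L := L.continuous_of_finiteDimensional
  have hτM : ∀ r, r - τ r ∈ M := fun r => by
    rw [← hker, RingHom.mem_ker]
    simp [τ, hσ]
  have hunit : ∀ r, r ∉ M → IsUnit (τ r) := fun r hr => by
    have : IsUnit (π r) := by
      rw [isUnit_iff_ne_zero]
      intro h
      exact hr (hker ▸ (RingHom.mem_ker.2 h))
    exact this.map σ
  -- Dividing by the residue part lands in `1 + M` and forgets scalars. Modulo `M * M`,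
  -- multiplication in `1 + M` is addition in `M`, so `L` turns `g ∘ S` into an additive function.
  let g : R → R := fun r => Ring.inverse (τ r) * r
  have hgM : ∀ r, r ∉ M → g r - 1 ∈ M := fun r hr => by
    have : g r - 1 = Ring.inverse (τ r) * (r - τ r) := by
      rw [mul_sub, Ring.inverse_mul_cancel _ (hunit r hr)]
    rw [this]
    exact M.mul_mem_left _ (hτM r)
  have hgmul : ∀ r s, g (r * s) = g r * g s := fun r s => by
    simp only [g, map_mul]
    rw [Ring.mul_inverse_rev]
    ring
  have hgz : ∀ (z : 𝕜) r, z ≠ 0 → g (z • r) = g r := fun z r hz => by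
    have hu : IsUnit (algebraMap 𝕜 R z) := (isUnit_iff_ne_zero.2 hz).map _
    rw [Algebra.smul_def, hgmul]
    simp only [g, AlgHom.commutes]
    rw [Ring.inverse_mul_cancel _ hu, one_mul]
  have hgc : ∀ r, r ∉ M → ContinuousAt g r := fun r hr => by
    obtain ⟨w, hw⟩ := hunit r hr
    have h1 : ContinuousAt (fun r => Ring.inverse (τ r)) r :=
      ContinuousAt.comp (g := Ring.inverse) (hw ▸ NormedRing.inverse_continuousAt w)
        hτ.continuousAt
    exact h1.mul continuousAt_id
  have hSM : ∀ t, S t ∉ M := fun t ht =>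
    hM.ne_top (M.eq_top_of_isUnit_mem ht (isUnit_of_continuous_mul hS h0 hadd t))
  let a : ℝ≥0 → ℝ := fun t => L (g (S t) - 1)
  have ha : Continuous a := by
    refine hLc.comp ((continuous_iff_continuousAt.2 fun t => ?_).sub continuous_const)
    exact ContinuousAt.comp (hgc _ (hSM t)) hS.continuousAt
  have haadd : ∀ s t, a (s + t) = a s + a t := fun s t => by
    have h := hL _ (Ideal.mul_mem_mul (hgM _ (hSM s)) (hgM _ (hSM t)))
    simp only [a]
    rw [← map_add, hadd, hgmul, ← sub_eq_zero, ← map_sub, ← h]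
    congr 1
    ring
  have hMopen : IsOpen {r : R | r ∉ M} := by
    have : IsClosed ((M.restrictScalars 𝕜 : Submodule 𝕜 R) : Set R) :=
      Submodule.closed_of_finiteDimensional _
    exact this.isOpen_compl
  -- Off `M`, `L (g r - 1)` is continuous and blind to scalars, so density carries a closed
  -- constraint on `a` to every `r ∉ M`; yet the points `1 + b • m` realise every real value.
  have hclosed : ∀ A : Set ℝ, IsClosed A → (∀ t, a t ∈ A) → ∀ r, r ∉ M → L (g r - 1) ∈ A := by
    intro A hA hAt r hr
    by_contra hcon
    have hcont : ContinuousAt (fun r => L (g r - 1)) r :=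
      hLc.continuousAt.comp ((hgc r hr).sub continuousAt_const)
    have h1 : ∀ᶠ x in 𝓝 r, L (g x - 1) ∉ A := hcont.eventually (hA.isOpen_compl.mem_nhds hcon)
    have h2 : ∀ᶠ x in 𝓝 r, x ∉ M := hMopen.mem_nhds hr
    obtain ⟨_, ⟨⟨z, t⟩, rfl⟩, hx1, hx2⟩ := (hD.inter_nhds_nonempty (h1.and h2))
    have hz : z ≠ 0 := by
      rintro rfl
      simp at hx2
    refine hx1 ?_
    simp only [hgz z _ hz]
    exact hAt t
  have hval : ∀ b : ℝ, L (g (1 + b • m) - 1) = b * L m ∧ 1 + b • m ∉ M := fun b => by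
    have hbm : b • m ∈ M := (M.restrictScalars ℝ).smul_mem b hmM
    have hπ0 : π (b • m) = 0 := by
      have : b • m ∈ RingHom.ker (π : R →+* R ⧸ M) := hker.symm ▸ hbm
      exact this
    constructor
    · have : τ (1 + b • m) = 1 := by
        simp only [τ, AlgHom.comp_apply, map_add, map_one, hπ0, map_zero, add_zero]
      simp [g, this]
    · intro h
      have := M.sub_mem h hbm
      rw [add_sub_cancel_right] at this
      exact hM.ne_top ((Ideal.eq_top_iff_one M).2 this)
  rcases bddAbove_or_bddBelow_of_continuous_add ha haadd with ⟨C, hC⟩ | ⟨C, hC⟩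
  · have h := hclosed (Set.Iic C) isClosed_Iic hC _ (hval ((C + 1) / L m)).2
    rw [(hval _).1, div_mul_cancel₀ _ hLm, Set.mem_Iic] at h
    linarith
  · have h := hclosed (Set.Ici C) isClosed_Ici hC _ (hval ((C - 1) / L m)).2
    rw [(hval _).1, div_mul_cancel₀ _ hLm, Set.mem_Ici] at h
    linarith

/-- A commutative algebra in which the multiples of a continuous one-parameter semigroup are dense
has real dimension at most two. -/
theorem realDim_le_two_of_dense_semigroup (hS : Continuous S) (h0 : S 0 = 1)
    (hadd : ∀ s t, S (s + t) = S s * S t)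
    (hD : Dense (Set.range fun p : 𝕜 × ℝ≥0 => p.1 • S p.2)) : realDim 𝕜 R ≤ 2 := by
  let _ : NormedAlgebra ℝ R := NormedAlgebra.restrictScalars ℝ 𝕜 R
  have : IsScalarTower ℝ 𝕜 R := RestrictScalars.isScalarTower ℝ 𝕜 R
  have : FiniteDimensional ℝ R := FiniteDimensional.trans ℝ 𝕜 R
  change Module.rank ℝ R ≤ 2
  rcases subsingleton_or_nontrivial R with h | h
  · rw [rank_subsingleton']
    exact zero_le
  obtain ⟨M, hM⟩ := Ideal.exists_maximal R
  have hbot := maximalIdeal_eq_bot_of_dense_semigroup hS h0 hadd hD M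
  let _ := Ideal.Quotient.field M
  let ψ : (R ⧸ M) →ₐ[ℝ] ℂ := IsAlgClosed.lift
  let f : R →ₗ[ℝ] ℂ := (ψ.comp (Ideal.Quotient.mkₐ ℝ M)).toLinearMap
  have hf : Function.Injective f := by
    rw [injective_iff_map_eq_zero]
    intro r hr
    have h1 : ψ (Ideal.Quotient.mk M r) = 0 := hr
    rw [map_eq_zero, Ideal.Quotient.eq_zero_iff_mem, hbot] at h1
    exact h1
  have := LinearMap.finrank_le_finrank_of_injective hf
  rw [Complex.finrank_real_complex] at this
  rw [← Module.finrank_eq_rank]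
  exact_mod_cast this

end Algebra

/-! ### Comparison of real dimensions -/

section RealDimension

universe u v w

theorem lift_realDim_le_of_injective {𝕜 : Type w} {V : Type u} {V' : Type v} [RCLike 𝕜]
    [AddCommGroup V] [Module 𝕜 V] [AddCommGroup V'] [Module 𝕜 V'] (f : V →ₗ[𝕜] V')
    (hf : Function.Injective f) :
    Cardinal.lift.{v} (realDim 𝕜 V) ≤ Cardinal.lift.{u} (realDim 𝕜 V') := by
  let _ : Module ℝ V := Module.compHom V (algebraMap ℝ 𝕜)
  let _ : Module ℝ V' := Module.compHom V' (algebraMap ℝ 𝕜)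
  let g : V →ₗ[ℝ] V' := { toFun := f, map_add' := map_add f, map_smul' := fun r x => map_smul f _ x }
  exact LinearMap.lift_rank_le_of_injective g hf

theorem realDim_le_two_of_injective {𝕜 : Type w} {V : Type u} {V' : Type v} [RCLike 𝕜]
    [AddCommGroup V] [Module 𝕜 V] [AddCommGroup V'] [Module 𝕜 V'] (f : V →ₗ[𝕜] V')
    (hf : Function.Injective f) (h : realDim 𝕜 V' ≤ 2) : realDim 𝕜 V ≤ 2 := by
  have h1 := (lift_realDim_le_of_injective f hf).trans (Cardinal.lift_le.2 h)
  rw [Cardinal.lift_ofNat] at h1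
  simpa using h1

/-- A family of operators for which every vector lies in a finite-dimensional invariant subspace
has, on a space of real dimension more than two, such a subspace of real dimension more than two. -/
theorem exists_finiteDimensional_invariant_two_lt_realDim {𝕜 V ι : Type*} [RCLike 𝕜]
    [AddCommGroup V] [Module 𝕜 V] {T : ι → V →ₗ[𝕜] V} (hdim : 2 < realDim 𝕜 V)
    (hT : ∀ v, ∃ Y : Submodule 𝕜 V, FiniteDimensional 𝕜 Y ∧ (∀ t, ∀ y ∈ Y, T t y ∈ Y) ∧ v ∈ Y) :
    ∃ W : Submodule 𝕜 V, FiniteDimensional 𝕜 W ∧ (∀ t, ∀ y ∈ W, T t y ∈ W) ∧ 2 < realDim 𝕜 W := by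
  let _ : Module ℝ V := Module.compHom V (algebraMap ℝ 𝕜)
  change 2 < Module.rank ℝ V at hdim
  have h3 : ((3 : ℕ) : Cardinal) ≤ Module.rank ℝ V := by
    by_contra hlt
    obtain ⟨n, hn⟩ := Cardinal.lt_aleph0.1 ((not_le.1 hlt).trans Cardinal.natCast_lt_aleph0)
    rw [hn] at hdim hlt
    have h1 : 2 < n := by exact_mod_cast hdim
    have h2 : n < 3 := by exact_mod_cast not_le.1 hlt
    lia
  obtain ⟨s, hs, hli⟩ := le_rank_iff_exists_linearIndependent_finset.1 h3
  choose Y hfin hY hmem using hT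
  -- Invariant subspaces of three real-independent vectors are enough.
  let W : Submodule 𝕜 V := ⨆ v : s, Y v
  have hle : ∀ v : s, Y v ≤ W := fun v => le_iSup (fun v : s => Y v) v
  refine ⟨W, Submodule.finiteDimensional_iSup _, fun t => ?_, ?_⟩
  · have : W ≤ W.comap (T t) := iSup_le fun v y hy => hle v (hY _ t y hy)
    exact this
  · let _ : Module ℝ W := Module.compHom W (algebraMap ℝ 𝕜)
    change 2 < Module.rank ℝ W
    let i : W →ₗ[ℝ] V := { toFun := W.subtype, map_add' := fun _ _ => rfl, map_smul' := fun _ _ => rfl }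
    let f : ↥(s : Set V) → W := fun v => ⟨v, hle v (hmem v)⟩
    have hf : LinearIndependent ℝ f := LinearIndependent.of_comp i hli
    have := hf.cardinal_le_rank
    have hcard : Cardinal.mk ↥(s : Set V) = 3 := by
      rw [Finset.coe_sort_coe, Cardinal.mk_coe_finset, hs]
      norm_num
    rw [hcard] at this
    exact lt_of_lt_of_le (by norm_num) this

end RealDimension

/-! ### Supercyclic semigroups on finite-dimensional spaces and factors -/

section FiniteDimensional

variable {𝕜 X F : Type*} [RCLike 𝕜] [AddCommGroup X] [Module 𝕜 X] [TopologicalSpace X]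
  [NormedAddCommGroup F] [NormedSpace 𝕜 F] [FiniteDimensional 𝕜 F]

/-- Supercyclic strongly continuous semigroups live only on finite-dimensional spaces of real
dimension at most two. -/
theorem realDim_le_two_of_supercyclic (T : OperatorSemigroup ℝ≥0 𝕜 F) (hT : T.StronglyContinuous)
    (hsc : T.Supercyclic) : realDim 𝕜 F ≤ 2 := by
  obtain ⟨x, hx⟩ := hsc
  have hcomm : ∀ a ∈ Set.range T.op, ∀ b ∈ Set.range T.op, a * b = b * a := by
    rintro _ ⟨s, rfl⟩ _ ⟨t, rfl⟩
    change (T.op s).comp (T.op t) = (T.op t).comp (T.op s)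
    rw [← T.op_add, ← T.op_add, add_comm]
  let R := Algebra.adjoin 𝕜 (Set.range T.op)
  have hR : IsMulCommutative R := Algebra.isMulCommutative_adjoin 𝕜 hcomm
  let _ : NormedCommRing R :=
    { (inferInstance : NormedRing R) with mul_comm := fun a b => hR.is_comm.comm a b }
  let _ : NormedAlgebra 𝕜 R := Subalgebra.toNormedAlgebra R
  have hfd : FiniteDimensional 𝕜 R := FiniteDimensional.finiteDimensional_submodule R.toSubmodule
  let S : ℝ≥0 → R := fun t => ⟨T.op t, Algebra.subset_adjoin ⟨t, rfl⟩⟩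
  have hS : Continuous S := (continuous_clm_apply.2 hT).subtype_mk _
  let ev : R →ₗ[𝕜] F :=
    { toFun := fun r => (r : F →L[𝕜] F) x, map_add' := fun _ _ => rfl, map_smul' := fun _ _ => rfl }
  have hevS : ∀ t, ev (S t) = T.op t x := fun _ => rfl
  -- An element of `R` killing `x` commutes with the semigroup, so it kills a dense set.
  have hinj : Function.Injective ev := by
    rw [injective_iff_map_eq_zero]
    intro r hr
    have hr' : (r : F →L[𝕜] F) x = 0 := hr
    refine Subtype.ext ?_
    refine ContinuousLinearMap.ext fun y => ?_
    have hEq : Set.EqOn (fun y => (r : F →L[𝕜] F) y) (fun _ => 0)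
        (Set.range fun p : 𝕜 × ℝ≥0 => p.1 • T.op p.2 x) := by
      rintro _ ⟨⟨z, t⟩, rfl⟩
      have h1 : r * S t = S t * r := hR.is_comm.comm _ _
      have h2 : (r : F →L[𝕜] F) (T.op t x) = T.op t ((r : F →L[𝕜] F) x) :=
        congrArg (fun a : R => (a : F →L[𝕜] F) x) h1
      simp only [map_smul, h2, hr', map_zero, smul_zero]
    exact congrFun (Continuous.ext_on hx (r : F →L[𝕜] F).continuous continuous_const hEq) y
  have hsurj : Function.Surjective ev := by
    rw [← LinearMap.range_eq_top]
    have hcl : IsClosed (LinearMap.range ev : Set F) := Submodule.closed_of_finiteDimensional _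
    refine SetLike.coe_injective ?_
    rw [Submodule.top_coe, ← hcl.closure_eq]
    refine (hx.mono ?_).closure_eq
    rintro _ ⟨⟨z, t⟩, rfl⟩
    exact ⟨z • S t, by rw [map_smul, hevS]⟩
  let e : R ≃ₗ[𝕜] F := LinearEquiv.ofBijective ev ⟨hinj, hsurj⟩
  have hec : Continuous e.symm := e.symm.toLinearMap.continuous_of_finiteDimensional
  have hD : Dense (Set.range fun p : 𝕜 × ℝ≥0 => p.1 • S p.2) := by
    refine (e.symm.surjective.denseRange.dense_image hec hx).mono ?_
    rintro _ ⟨_, ⟨⟨z, t⟩, rfl⟩, rfl⟩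
    refine ⟨(z, t), ?_⟩
    rw [LinearEquiv.eq_symm_apply]
    change ev (z • S t) = _
    rw [map_smul, hevS]
  refine realDim_le_two_of_injective e.symm.toLinearMap e.symm.injective
    (realDim_le_two_of_dense_semigroup (𝕜 := 𝕜) (R := R) hS ?_ ?_ hD)
  · exact Subtype.ext T.op_zero
  · intro s t
    rw [mul_comm]
    exact Subtype.ext (T.op_add s t)

/-- Finite-dimensional factors of supercyclic strongly continuous semigroups have real dimension at
most two. -/
theorem realDim_le_two_of_factor (T : OperatorSemigroup ℝ≥0 𝕜 X) (hT : T.StronglyContinuous)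
    (hsc : T.Supercyclic) (q : X →L[𝕜] F) (hq : Function.Surjective q)
    (hker : ∀ t y, q y = 0 → q (T.op t y) = 0) : realDim 𝕜 F ≤ 2 := by
  obtain ⟨x, hx⟩ := hsc
  obtain ⟨σ, hσ⟩ := q.toLinearMap.exists_rightInverse_of_surjective (LinearMap.range_eq_top.2 hq)
  have hqσ : ∀ y, q (σ y) = y := fun y => LinearMap.congr_fun hσ y
  have hint : ∀ t y, q (T.op t (σ (q y))) = q (T.op t y) := by
    intro t y
    rw [← sub_eq_zero, ← map_sub, ← map_sub]
    exact hker t _ (by rw [map_sub, hqσ, sub_self])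
  -- The induced semigroup does not depend on the section `σ`, as the kernel of `q` is invariant.
  let T' : OperatorSemigroup ℝ≥0 𝕜 F :=
    { op := fun t => (q.toLinearMap ∘ₗ (T.op t).toLinearMap ∘ₗ σ).toContinuousLinearMap
      op_zero := by
        ext y
        simp [T.op_zero, hqσ]
      op_add := fun s t => by
        ext y
        simp [T.op_add, hint] }
  have hT' : ∀ t y, T'.op t (q y) = q (T.op t y) := hint
  refine realDim_le_two_of_supercyclic T' (fun y => ?_) ⟨q x, ?_⟩
  · obtain ⟨y, rfl⟩ := hq y
    simp only [hT']
    exact q.continuous.comp (hT y)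
  · refine (hq.denseRange.dense_image q.continuous hx).mono ?_
    rintro _ ⟨_, ⟨⟨z, t⟩, rfl⟩, rfl⟩
    exact ⟨(z, t), by simp [hT']⟩

end FiniteDimensional

/-! ### The two cases of the theorem -/

section Main

variable {𝕜 X : Type*} [RCLike 𝕜] [AddCommGroup X] [Module 𝕜 X] [TopologicalSpace X]

/-- On a space of real dimension less than the continuum, supercyclic strongly continuous semigroups
exist only in real dimension at most two. -/
theorem realDim_le_two_of_realDim_lt [IsTopologicalAddGroup X] [ContinuousSMul 𝕜 X] [T2Space X]
    (T : OperatorSemigroup ℝ≥0 𝕜 X) (hT : T.StronglyContinuous) (hsc : T.Supercyclic)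
    (hdim : realDim 𝕜 X < 2 ^ ℵ₀) : realDim 𝕜 X ≤ 2 := by
  obtain ⟨x, hx⟩ := hsc
  obtain ⟨Y, hfin, hY, hxY⟩ := exists_finiteDimensional_invariant
    (T := fun t => (T.op t).toLinearMap) (by ext y; simp [T.op_zero])
    (fun s t => by ext y; simp [T.op_add]) hT hdim x
  -- `Y` is closed and contains the dense set of multiples of the orbit of `x`.
  have htop : Y = ⊤ := by
    have hcl : IsClosed (Y : Set X) := Submodule.closed_of_finiteDimensional _
    refine SetLike.coe_injective ?_
    rw [Submodule.top_coe, ← hcl.closure_eq]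
    refine (hx.mono ?_).closure_eq
    rintro _ ⟨⟨z, t⟩, rfl⟩
    exact Y.smul_mem z (hY t x hxY)
  have : FiniteDimensional 𝕜 X := by
    rw [htop] at hfin
    exact Module.finite_def.2 (Module.Finite.iff_fg.1 hfin)
  let e : X ≃L[𝕜] (Fin (Module.finrank 𝕜 X) → 𝕜) := ContinuousLinearEquiv.ofFinrankEq (by simp)
  refine realDim_le_two_of_injective e.toLinearMap e.injective
    (realDim_le_two_of_factor T hT ⟨x, hx⟩ (e : X →L[𝕜] _) e.surjective fun t y hy => ?_)
  have : y = 0 := e.map_eq_zero_iff.1 hy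
  simp [this]

/-- Finite-dimensional invariant spaces of functionals of supercyclic strongly continuous semigroups
have real dimension at most two. -/
theorem realDim_le_two_of_invariant_functionals (T : OperatorSemigroup ℝ≥0 𝕜 X)
    (hT : T.StronglyContinuous) (hsc : T.Supercyclic) {W : Type*} [AddCommGroup W] [Module 𝕜 W]
    [FiniteDimensional 𝕜 W] (j : W →ₗ[𝕜] X →L[𝕜] 𝕜) (hj : Function.Injective j)
    (hW : ∀ t f, ∃ g, ∀ x, j g x = j f (T.op t x)) : realDim 𝕜 W ≤ 2 := by
  let b := Module.finBasis 𝕜 W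
  let q : X →L[𝕜] (Fin (Module.finrank 𝕜 W) → 𝕜) := ContinuousLinearMap.pi fun i => j (b i)
  have hqi : ∀ x i, q x i = j (b i) x := fun _ _ => rfl
  have hcomb : ∀ (c : Fin (Module.finrank 𝕜 W) → 𝕜) x,
      j (∑ i, c i • b i) x = ∑ i, c i * q x i := by
    intro c x
    simp [map_sum, hqi]
  -- A functional vanishing on a proper range would be a linear relation among the `j (b i)`.
  have hq : Function.Surjective q := by
    by_contra hcon
    obtain ⟨y, hy⟩ := not_forall.1 hcon
    obtain ⟨f, hf, hle⟩ := Submodule.exists_le_ker_of_notMem (K := 𝕜)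
      (p := LinearMap.range q.toLinearMap) (v := y) hy
    have hfc : ∀ v, f v = ∑ i, f (Pi.single i 1) * v i := fun v => by
      conv_lhs => rw [pi_eq_sum_univ' v]
      simp [map_sum, mul_comm]
    have hzero : (∑ i, f (Pi.single i 1) • b i : W) = 0 := by
      refine hj (ContinuousLinearMap.ext fun x => ?_)
      rw [hcomb, ← hfc, map_zero]
      exact hle ⟨x, rfl⟩
    have := Fintype.linearIndependent_iff.1 b.linearIndependent _ hzero
    exact hf (by rw [hfc]; simp [this])
  have hker : ∀ t y, q y = 0 → q (T.op t y) = 0 := by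
    intro t y hy
    funext i
    obtain ⟨g, hgx⟩ := hW t (b i)
    rw [hqi, ← hgx]
    have h := hcomb (b.repr g) y
    rw [b.sum_repr] at h
    rw [h, hy]
    simp
  exact realDim_le_two_of_injective b.equivFun.toLinearMap b.equivFun.injective
    (realDim_le_two_of_factor T hT hsc q hq hker)

/-- A version of `realDim_dual_le_two_of_realDim_dual_lt` for a space `V` of functionals with a vector
topology for which the adjoint semigroup `S` is strongly continuous. -/
theorem realDim_le_two_of_adjoint (T : OperatorSemigroup ℝ≥0 𝕜 X)
    (hT : T.StronglyContinuous) (hsc : T.Supercyclic) {V : Type*} [AddCommGroup V] [Module 𝕜 V]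
    [TopologicalSpace V] [IsTopologicalAddGroup V] [ContinuousSMul 𝕜 V] [T2Space V]
    (j : V →ₗ[𝕜] X →L[𝕜] 𝕜) (hj : Function.Injective j) (S : ℝ≥0 → V →ₗ[𝕜] V)
    (hS : ∀ t f x, j (S t f) x = j f (T.op t x)) (hcont : ∀ f, Continuous fun t => S t f)
    (hdim : realDim 𝕜 V < 2 ^ ℵ₀) : realDim 𝕜 V ≤ 2 := by
  refine not_lt.1 fun h2 => ?_
  obtain ⟨W, hfin, hW, h3⟩ := exists_finiteDimensional_invariant_two_lt_realDim (T := S) h2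
    (exists_finiteDimensional_invariant
      (LinearMap.ext fun f => hj (ContinuousLinearMap.ext fun x => by simp [hS, T.op_zero]))
      (fun s t => LinearMap.ext fun f => hj (ContinuousLinearMap.ext fun x => by
        rw [LinearMap.comp_apply, hS, hS, hS, add_comm, T.op_add]
        rfl)) hcont hdim)
  exact absurd (realDim_le_two_of_invariant_functionals T hT hsc
    (j ∘ₗ W.subtype) (hj.comp W.subtype_injective)
    fun t f => ⟨⟨S t f, hW t f f.2⟩, hS t f⟩) (not_le.2 h3)

/-- If the dual has real dimension less than the continuum, then supercyclic strongly continuous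
semigroups exist only when the dual has real dimension at most two. -/
theorem realDim_dual_le_two_of_realDim_dual_lt
    (T : OperatorSemigroup ℝ≥0 𝕜 X) (hT : T.StronglyContinuous) (hsc : T.Supercyclic)
    (hdim : realDim 𝕜 (X →L[𝕜] 𝕜) < 2 ^ ℵ₀) : realDim 𝕜 (X →L[𝕜] 𝕜) ≤ 2 := by
  -- In the weak-* topology, strong continuity of the adjoint semigroup is just continuity of each
  -- `t ↦ f (T.op t x)`.
  let e : (X →L[𝕜] 𝕜) ≃ₗ[𝕜] WeakDual 𝕜 X := StrongDual.toWeakDual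
  have hdim' : realDim 𝕜 (WeakDual 𝕜 X) < 2 ^ ℵ₀ := by
    have := lift_realDim_le_of_injective e.symm.toLinearMap e.symm.injective
    rw [Cardinal.lift_id, Cardinal.lift_id] at this
    exact this.trans_lt hdim
  refine realDim_le_two_of_injective e.toLinearMap e.injective
    (realDim_le_two_of_adjoint T hT hsc e.symm.toLinearMap e.symm.injective
      (fun t => e.toLinearMap ∘ₗ ((ContinuousLinearMap.precomp 𝕜 (T.op t)).toLinearMap) ∘ₗ
        e.symm.toLinearMap) (fun _ _ _ => rfl) (fun f => ?_) hdim')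
  exact WeakDual.continuous_of_continuous_eval fun x => (map_continuous f).comp (hT x)

end Main

theorem mainTheorem2 {𝕜 X : Type*} [RCLike 𝕜] [AddCommGroup X] [Module 𝕜 X]
    [TopologicalSpace X] [IsTopologicalAddGroup X] [ContinuousSMul 𝕜 X] [T2Space X]
    (h : (2 < realDim 𝕜 X ∧ realDim 𝕜 X < 2 ^ ℵ₀) ∨
      (2 < realDim 𝕜 (X →L[𝕜] 𝕜) ∧ realDim 𝕜 (X →L[𝕜] 𝕜) < 2 ^ ℵ₀)) :
    ¬ ∃ T : OperatorSemigroup ℝ≥0 𝕜 X, T.StronglyContinuous ∧ T.Supercyclic := by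
  rintro ⟨T, hT, hsc⟩
  rcases h with ⟨h2, hc⟩ | ⟨h2, hc⟩
  · exact not_lt.2 (realDim_le_two_of_realDim_lt T hT hsc hc) h2
  · exact not_lt.2 (realDim_dual_le_two_of_realDim_dual_lt T hT hsc hc) h2
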